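/- A Hausdorff space is called Souslin if it is the image of a complete separable metric space under a continuous mapping; a subset of a topological space is called Souslin if it is a Souslin space in the induced topology. For a Souslin space $T$ let $\mathcal{B}(T)$ be its Borel $\sigma$-algebra and $\sigma(\mathcal{S}(T))$ the $\sigma$-algebra generated by all Souslin subsets of $T$. For a completely regular Souslin space $X$ let $\mathcal{P}(X)$ be the space of Borel probability measures on $X$ with the weak topology generated by the functions $\mu\mapsto\int_X f\,d\mu$, where $f$ is a bounded continuous function on $X$. Let $X$ and $Y$ be completely regular Souslin spaces and let $T$ be a Souslin space. Let $h\colon T\times X\times Y\to[0,+\infty)$ be a $\mathcal{B}(T)\otimes\mathcal{B}(X)\otimes\mathcal{B}(Y)$-measurable function such that for every $t\in T$ the function $h_t\colon (x,y)\mapsto h(t,x,y)$ is continuous on $X\times Y$. Let $t\mapsto\mu_t$, $T\to\mathcal{P}(X)$, and $t\mapsto\nu_t$, $T\to\mathcal{P}(Y)$, be Borel measurable mappings. For $t\in T$ put $$ K(t)=K_{h_t}(\mu_t,\nu_t)=\inf_{\sigma\in\Pi(\mu_t,\nu_t)}\int_{X\times Y}h_t\,d\sigma\in[0,+\infty], $$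 where $\Pi(\mu_t,\nu_t)$ is the set of all probability measures on $\mathcal{B}(X)\otimes\mathcal{B}(Y)$ with projections $\mu_t$ and $\nu_t$ on $X$ and $Y$. Then the function $K\colon T\to[0,+\infty]$ is measurable with respect to $\sigma(\mathcal{S}(T))$. -/

import Mathlib

open MeasureTheory Set Topology
open scoped NNReal ENNReal

/-- A Souslin space: a Hausdorff space that is a continuous image of a Polish space
(for the whole space, `AnalyticSet univ` says exactly this; the empty space is allowed). -/
class SouslinSpace (X : Type*) [TopologicalSpace X] : Prop extends T2Space X where
  analyticSet_univ : AnalyticSet (univ : Set X)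

theorem souslinSpace_iff (X : Type*) [TopologicalSpace X] :
    SouslinSpace X ↔ T2Space X ∧ ∃ (P : Type) (_ : TopologicalSpace P) (_ : PolishSpace P)
      (f : P → X), Continuous f ∧ Function.Surjective f := by
  constructor
  · intro h
    obtain ⟨P, i, j, f, hf, hr⟩ := analyticSet_iff_exists_polishSpace_range.1 h.analyticSet_univ
    exact ⟨h.toT2Space, P, i, j, f, hf, range_eq_univ.1 hr⟩
  · rintro ⟨h2, P, i, j, f, hf, hs⟩
    exact { toT2Space := h2
            analyticSet_univ :=
              analyticSet_iff_exists_polishSpace_range.2 ⟨P, i, j, f, hf, range_eq_univ.2 hs⟩ }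

/-- The σ-algebra `σ(𝒮(T))` generated by the Souslin (analytic) subsets of `T`. -/
@[reducible] def souslinSigmaAlgebra (T : Type*) [TopologicalSpace T] : MeasurableSpace T :=
  MeasurableSpace.generateFrom {A : Set T | AnalyticSet A}

/-- The set `Π(μ, ν)` of transport plans: the probability measures on the product σ-algebra
of `X × Y` with projections `μ` and `ν` on the factors. -/
def transportPlans {X Y : Type*} [MeasurableSpace X] [MeasurableSpace Y]
    (μ : ProbabilityMeasure X) (ν : ProbabilityMeasure Y) : Set (ProbabilityMeasure (X × Y)) :=
  {σ | (σ : Measure (X × Y)).map Prod.fst = (μ : Measure X) ∧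
    (σ : Measure (X × Y)).map Prod.snd = (ν : Measure Y)}

/-- The Kantorovich transportation cost `K_h(μ, ν)`, the infimum of `∫ h dσ` over all
transport plans `σ`, as an element of `[0, ∞]`. -/
noncomputable def kantorovichCost {X Y : Type*} [MeasurableSpace X] [MeasurableSpace Y]
    (h : X × Y → ℝ≥0) (μ : ProbabilityMeasure X) (ν : ProbabilityMeasure Y) : ℝ≥0∞ :=
  ⨅ σ ∈ transportPlans μ ν, ∫⁻ z, (h z : ℝ≥0∞) ∂(σ : Measure (X × Y))

open Filter ProbabilityTheory

/-! The cost is below `c` at `t` exactly when some plan with the right marginals has integral below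
`c`, so the sublevel set is a projection along the space of plans. To project from a Polish space,
`T` is replaced by a Polish `P` mapping onto it, and plans are parametrized by a Markov kernel on `ℚ
→ ℝ` that attains every probability measure on `X × Y` (`SouslinSpace.exists_surjective_kernel`).
The conditions on the marginals and on the integral are then Borel in `P × (ℚ → ℝ)`, so the sublevel
set is Souslin. The kernel comes from distribution functions on `ℝ`, carried to a Souslin space by
an almost everywhere measurable selection. -/

/-! ### Borel structure of Souslin spaces -/

instance SouslinSpace.hereditarilyLindelofSpace {X : Type*} [TopologicalSpace X]
    [SouslinSpace X] : HereditarilyLindelofSpace X := by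
  obtain ⟨-, P, i, j, f, hf, hs⟩ := (souslinSpace_iff X).1 ‹_›
  refine .of_forall_isOpen fun s _ => ?_
  rw [← image_preimage_eq s hs]
  exact (HereditarilyLindelofSpace.isLindelof (f ⁻¹' s)).image hf

instance SouslinSpace.prod {X Y : Type*} [TopologicalSpace X] [SouslinSpace X]
    [TopologicalSpace Y] [SouslinSpace Y] : SouslinSpace (X × Y) := by
  obtain ⟨-, P, i, j, f, hf, hs⟩ := (souslinSpace_iff X).1 ‹_›
  obtain ⟨-, Q, i', j', g, hg, hs'⟩ := (souslinSpace_iff Y).1 ‹_›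
  exact (souslinSpace_iff _).2
    ⟨inferInstance, P × Q, inferInstance, inferInstance, Prod.map f g, hf.prodMap hg, hs.prodMap hs'⟩

/-- By the hereditary Lindelöf property, countably many open boxes suffice to fill an open set. -/
instance SouslinSpace.prod_borelSpace {X Y : Type*} [TopologicalSpace X] [SouslinSpace X]
    [MeasurableSpace X] [BorelSpace X] [TopologicalSpace Y] [SouslinSpace Y]
    [MeasurableSpace Y] [BorelSpace Y] : BorelSpace (X × Y) := by
  refine ⟨le_antisymm prod_le_borel_prod (MeasurableSpace.generateFrom_le fun U hU => ?_)⟩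
  have key : ∀ z : U, ∃ V : Set X × Set Y, IsOpen V.1 ∧ IsOpen V.2 ∧ z.1 ∈ V.1 ×ˢ V.2 ∧
      V.1 ×ˢ V.2 ⊆ U := fun z => by
    obtain ⟨V, W, hV, hW, h1, h2, h3⟩ := isOpen_prod_iff.1 hU z.1.1 z.1.2 z.2
    exact ⟨(V, W), hV, hW, ⟨h1, h2⟩, h3⟩
  choose V hV1 hV2 hzV hVU using key
  obtain ⟨t, ht, htU⟩ := eq_open_union_countable (fun z : U => (V z).1 ×ˢ (V z).2)
    fun z => (hV1 z).prod (hV2 z)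
  have hU' : U = ⋃ z ∈ t, (V z).1 ×ˢ (V z).2 := by
    rw [htU]
    exact Subset.antisymm (fun z hz => mem_iUnion.2 ⟨⟨z, hz⟩, hzV ⟨z, hz⟩⟩) (iUnion_subset hVU)
  rw [hU']
  exact .biUnion ht fun z _ => (hV1 z).measurableSet.prod (hV2 z).measurableSet

/-- The complement of the diagonal is covered by countably many boxes with disjoint sides. -/
instance SouslinSpace.hasCountableSeparatingOn_isOpen {X : Type*} [TopologicalSpace X]
    [SouslinSpace X] : HasCountableSeparatingOn X IsOpen univ := by
  have key : ∀ z : {z : X × X // z.1 ≠ z.2}, ∃ V : Set X × Set X, IsOpen V.1 ∧ IsOpen V.2 ∧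
      z.1.1 ∈ V.1 ∧ z.1.2 ∈ V.2 ∧ Disjoint V.1 V.2 := fun z => by
    obtain ⟨V, W, h⟩ := t2_separation z.2
    exact ⟨(V, W), h⟩
  choose V hV1 hV2 hx hy hd using key
  obtain ⟨t, ht, htU⟩ := eq_open_union_countable (fun z => (V z).1 ×ˢ (V z).2)
    fun z => (hV1 z).prod (hV2 z)
  refine ⟨(fun z => (V z).1) '' t, ht.image _, forall_mem_image.2 fun z _ => hV1 z,
    fun x _ y _ hxy => ?_⟩
  by_contra hne
  have hmem : (x, y) ∈ ⋃ z, (V z).1 ×ˢ (V z).2 :=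
    mem_iUnion.2 ⟨⟨(x, y), hne⟩, hx ⟨(x, y), hne⟩, hy ⟨(x, y), hne⟩⟩
  rw [← htU] at hmem
  obtain ⟨z, hz, h1, h2⟩ := mem_iUnion₂.1 hmem
  exact disjoint_left.1 (hd z) ((hxy _ (mem_image_of_mem _ hz)).1 h1) h2

instance SouslinSpace.countablySeparated {X : Type*} [TopologicalSpace X] [SouslinSpace X]
    [MeasurableSpace X] [BorelSpace X] : MeasurableSpace.CountablySeparated X :=
  ⟨HasCountableSeparatingOn.mono (t₁ := univ) (p₁ := IsOpen)
    (fun _ hs => hs.measurableSet) subset_rfl⟩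

instance SouslinSpace.countablyGenerated {X : Type*} [TopologicalSpace X] [SouslinSpace X]
    [m : MeasurableSpace X] [BorelSpace X] : MeasurableSpace.CountablyGenerated X := by
  obtain ⟨-, P, i, j, f, hf, hs⟩ := (souslinSpace_iff X).1 ‹_›
  let : MeasurableSpace P := borel P
  have : BorelSpace P := ⟨rfl⟩
  have hfm : Measurable f := hf.measurable
  have h1 := hfm.map_measurableSpace_eq hs
  obtain ⟨m', hg, hsep, hle⟩ :=
    MeasurableSpace.exists_countablyGenerated_le_of_countablySeparated (α := X)
  -- A countably separated σ-algebra for which `f` is measurable is the pushforward of that of `P`;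
  -- hence `m'` and the Borel σ-algebra coincide.
  have h2 := @Measurable.map_measurableSpace_eq P X _ _ m'
    (@MeasurableSpace.countablySeparated_of_separatesPoints X m' hg hsep) f
    (hfm.mono le_rfl hle) hs
  rwa [← h1, h2]

theorem measurableSet_setOf_measure_eq {A X : Type*} [MeasurableSpace A] [MeasurableSpace X]
    [MeasurableSpace.CountablyGenerated X] {m m' : A → Measure X} [∀ a, IsProbabilityMeasure (m a)]
    [∀ a, IsProbabilityMeasure (m' a)] (hm : Measurable m) (hm' : Measurable m') :
    MeasurableSet {a | m a = m' a} := by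
  obtain ⟨b, hb, hgen⟩ := MeasurableSpace.CountablyGenerated.isCountablyGenerated (α := X)
  rw [← generateFrom_generateSetAlgebra_eq] at hgen
  have heq : {a | m a = m' a} = ⋂ s ∈ generateSetAlgebra b, {a | m a s = m' a s} := by
    ext a
    simp only [mem_ofPred_eq, mem_iInter]
    refine ⟨fun h s _ => by rw [h], fun h => ext_of_generate_finite _ hgen ?_ h (by simp)⟩
    exact fun s hs t ht _ => isSetAlgebra_generateSetAlgebra.inter_mem hs ht
  rw [heq]
  refine .biInter (countable_generateSetAlgebra hb) fun s hs => ?_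
  have hsm : MeasurableSet s := hgen ▸ MeasurableSpace.measurableSet_generateFrom hs
  exact measurableSet_eq_fun (Measure.measurable_coe hsm |>.comp hm)
    (Measure.measurable_coe hsm |>.comp hm')

/-! ### Weak topology and evaluation of measures -/

/-- The complement of `F` is a countable union of cozero sets; the truncated `1 - n * ∑ f (k i)`
decreases to the indicator of `F`. -/
instance SouslinSpace.hasOuterApproxClosed {X : Type*} [TopologicalSpace X] [SouslinSpace X]
    [CompletelyRegularSpace X] : HasOuterApproxClosed X := by
  refine ⟨fun F hF => ?_⟩
  rcases Fᶜ.eq_empty_or_nonempty with hemp | hne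
  · have : F = univ := compl_empty_iff.1 hemp
    subst this
    refine ⟨fun _ => BoundedContinuousFunction.const X 1, by simp, by simp, ?_⟩
    simp
  have key : ∀ x : (Fᶜ : Set X), ∃ f : X → ℝ≥0, Continuous f ∧ f x ≠ 0 ∧ ∀ y ∈ F, f y = 0 :=
    fun x => by
    obtain ⟨f, hf, hx, h1⟩ := CompletelyRegularSpace.completely_regular x.1 F hF x.2
    refine ⟨fun y => Real.toNNReal (1 - f y), by fun_prop, by simp [hx], fun y hy => ?_⟩
    simp [h1 hy]
  choose f hf hx h0 using key
  have := hne.to_subtype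
  obtain ⟨k, hk⟩ := eq_open_union_nat (fun x => {y | f x y ≠ 0})
    fun x => isOpen_ne_fun (hf x) continuous_const
  let g : ℕ → X → ℝ≥0 := fun n y => n * ∑ i ∈ Finset.range n, f (k i) y
  have hg : ∀ n, Continuous (g n) := fun n => by fun_prop
  refine ⟨fun n => BoundedContinuousFunction.mkOfBound ⟨fun y => 1 - g n y, by fun_prop⟩ 1 ?_,
    fun n x => ?_, fun n x hxF => ?_, ?_⟩
  · intro x y
    have h1 : ∀ z, ((1 - g n z : ℝ≥0) : ℝ) ≤ 1 := fun z => by exact_mod_cast tsub_le_self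
    have h2 : ∀ z, 0 ≤ ((1 - g n z : ℝ≥0) : ℝ) := fun z => NNReal.coe_nonneg _
    rw [NNReal.dist_eq, abs_le]
    constructor <;> simp only [ContinuousMap.coe_mk] <;> linarith [h1 x, h1 y, h2 x, h2 y]
  · exact tsub_le_self
  · change 1 ≤ 1 - g n x
    simp [g, h0 _ x hxF]
  · refine tendsto_pi_nhds.2 fun y => ?_
    by_cases hy : y ∈ F
    · simp only [indicator_of_mem hy]
      refine tendsto_const_nhds.congr fun n => ?_
      change 1 = 1 - g n y
      simp [g, h0 _ y hy]
    · have hmem : y ∈ ⋃ x, {y | f x y ≠ 0} := mem_iUnion.2 ⟨⟨y, hy⟩, hx ⟨y, hy⟩⟩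
      rw [← hk] at hmem
      obtain ⟨i, hi⟩ := mem_iUnion.1 hmem
      simp only [indicator_of_notMem hy]
      refine tendsto_const_nhds.congr' ?_
      obtain ⟨M, hM⟩ := exists_nat_ge (f (k i) y)⁻¹
      filter_upwards [eventually_gt_atTop i, eventually_ge_atTop M] with n hn hMn
      change 0 = 1 - g n y
      refine (tsub_eq_zero_of_le ?_).symm
      calc (1 : ℝ≥0) = (f (k i) y)⁻¹ * f (k i) y := (inv_mul_cancel₀ hi).symm
        _ ≤ n * ∑ i ∈ Finset.range n, f (k i) y := by
          gcongr
          · exact hM.trans (by exact_mod_cast hMn)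
          · exact Finset.single_le_sum (f := fun i => f (k i) y) (fun _ _ => zero_le)
              (Finset.mem_range.2 hn)

theorem ProbabilityMeasure.measurable_coe_of_borel (X : Type*) [TopologicalSpace X]
    [HasOuterApproxClosed X] [MeasurableSpace X] [BorelSpace X] :
    Measurable[borel (ProbabilityMeasure X)]
      fun μ : ProbabilityMeasure X => (μ : Measure X) := by
  let : MeasurableSpace (ProbabilityMeasure X) := borel _
  have : BorelSpace (ProbabilityMeasure X) := ⟨rfl⟩
  refine Measurable.measure_of_isPiSystem_of_isProbabilityMeasure
    (BorelSpace.measurable_eq.trans (borel_eq_generateFrom_isClosed)) isPiSystem_isClosed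
    fun F hF => ?_
  have hF : IsClosed F := hF
  refine measurable_of_tendsto_metrizable (f := fun n (μ : ProbabilityMeasure X) =>
    ∫⁻ x, hF.apprSeq n x ∂(μ : Measure X)) (fun n => ?_) (tendsto_pi_nhds.2 fun μ =>
      HasOuterApproxClosed.tendsto_lintegral_apprSeq hF (μ : Measure X))
  exact Continuous.measurable (continuous_iff_continuousAt.2 fun μ =>
    ProbabilityMeasure.tendsto_iff_forall_lintegral_tendsto.1 tendsto_id (hF.apprSeq n))

/-! ### Measurable selection from fibres -/

theorem exists_continuous_injective_nat_nat_real :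
    ∃ j : (ℕ → ℕ) → ℝ, Continuous j ∧ Function.Injective j := by
  obtain ⟨c, -, hc, hci⟩ := (isClosed_univ (X := ℝ)).exists_nat_bool_injection_of_not_countable
    Cardinal.not_countable_real
  -- A sequence is encoded by the indicator of its graph, a point of the Cantor space.
  refine ⟨fun x => c fun n => decide (x n.unpair.1 = n.unpair.2), hc.comp ?_, fun x y hxy => ?_⟩
  · exact continuous_pi fun n =>
      (continuous_of_discreteTopology (f := fun m : ℕ => decide (m = n.unpair.2))).comp
        (continuous_apply _)
  · ext i
    have := congrFun (hci hxy) (Nat.pair i (y i))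
    simpa using this

/-- Capacitability: the mass of a continuous image of the Baire space is approximated by the
images of compact boxes. -/
theorem exists_le_measure_image_Iic {Z : Type*} [TopologicalSpace Z] [T2Space Z]
    [MeasurableSpace Z] [OpensMeasurableSpace Z] {f : (ℕ → ℕ) → Z} (hf : Continuous f)
    (μ : Measure Z) [IsFiniteMeasure μ] {r : ℝ≥0∞} (hr : r < μ (range f)) :
    ∃ n : ℕ → ℕ, r ≤ μ (f '' Iic n) := by
  let B : ℕ → (ℕ → ℕ) → Set (ℕ → ℕ) := fun k n => {x | ∀ i < k, x i ≤ n i}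
  have step : ∀ k (n : {n // r < μ (f '' B k n)}),
      ∃ m, r < μ (f '' B (k + 1) (Function.update n.1 k m)) := fun k n => by
    have hU : f '' B k n = ⋃ m, f '' B (k + 1) (Function.update n.1 k m) := by
      rw [← image_iUnion]
      congr 1
      ext x
      simp only [B, mem_ofPred_eq, mem_iUnion, Nat.lt_succ_iff_lt_or_eq]
      constructor
      · rintro h
        refine ⟨x k, ?_⟩
        rintro i (hi | rfl)
        · simpa [hi.ne] using h i hi
        · simp
      · rintro ⟨m, h⟩ i hi
        simpa [hi.ne] using h i (Or.inl hi)
    have hmono : Monotone fun m => f '' B (k + 1) (Function.update n.1 k m) := by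
      refine fun m m' hm => image_mono fun x hx i hi => (hx i hi).trans ?_
      exact update_le_update_iff.2 ⟨hm, fun _ _ => le_rfl⟩ i
    have := n.2
    rw [hU, hmono.measure_iUnion] at this
    exact lt_iSup_iff.1 this
  choose m hm using step
  let s : ∀ k, {n // r < μ (f '' B k n)} := fun k =>
    Nat.rec ⟨0, by simpa [B] using hr⟩ (fun k n => ⟨_, hm k n⟩) k
  have hs : ∀ k, (s (k + 1)).1 = Function.update (s k).1 k (m k (s k)) := fun _ => rfl
  let n : ℕ → ℕ := fun k => (s (k + 1)).1 k
  have hn : ∀ k, ∀ i < k, (s k).1 i = n i := fun k => by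
    induction k with
    | zero => simp
    | succ k ih =>
      intro i hi
      rcases Nat.lt_succ_iff_lt_or_eq.1 hi with hi | rfl
      · rw [hs, Function.update_of_ne hi.ne, ih i hi]
      · rfl
  have hB : ∀ k, r < μ (f '' B k n) := fun k => by
    have : B k n = B k (s k).1 := by
      ext x
      exact forall₂_congr fun i hi => by rw [hn k i hi]
    rw [this]
    exact (s k).2
  have hBanti : Antitone fun k => B k n := fun k l hkl x hx i hi => hx i (hi.trans_le hkl)
  have hK : IsCompact (Iic n) := by
    rw [← Icc_bot]
    exact isCompact_Icc
  -- `B k n` bounds only the first `k` coordinates and is not compact, yet by compactness of `Iic n`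
  -- it eventually enters each open set `f ⁻¹' V` containing `Iic n`.
  have hinter : f '' Iic n = ⋂ k, closure (f '' B k n) := by
    refine (subset_iInter fun k => ?_).antisymm fun y hy => ?_
    · have hsub : Iic n ⊆ B k n := fun x hx i _ => hx i
      exact (image_mono hsub).trans subset_closure
    · by_contra hyn
      obtain ⟨U, V, hU, hV, hyU, hKV, hUV⟩ :=
        SeparatedNhds.of_isCompact_isCompact isCompact_singleton (hK.image hf)
          (disjoint_singleton_left.2 hyn)
      have hex : ∃ k, B k n ⊆ f ⁻¹' V := by
        by_contra! hne
        choose x hxB hxV using fun k => not_subset.1 (hne k)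
        obtain ⟨a, ha, φ, hφ, hlim⟩ :=
          hK.tendsto_subseq (x := fun k => x k ⊓ n) fun k =>
            mem_Iic.2 inf_le_right
        have hlim' : Tendsto (x ∘ φ) atTop (𝓝 a) := by
          refine tendsto_pi_nhds.2 fun i => (tendsto_pi_nhds.1 hlim i).congr' ?_
          filter_upwards [eventually_gt_atTop i] with k hk
          exact inf_eq_left.2 (hxB (φ k) i (hk.trans_le hφ.le_apply))
        obtain ⟨k, hk⟩ := (hlim'.eventually_mem
          ((hV.preimage hf).mem_nhds (hKV (mem_image_of_mem f ha)))).exists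
        exact hxV _ hk
      obtain ⟨k, hk⟩ := hex
      have := mem_iInter.1 hy k
      obtain ⟨z, hzU, x, hx, rfl⟩ := mem_closure_iff.1 this U hU (hyU rfl)
      exact disjoint_left.1 hUV hzU (hk hx)
  refine ⟨n, ?_⟩
  rw [hinter, Antitone.measure_iInter (fun k l hkl => closure_mono (image_mono (hBanti hkl)))
    (fun k => isClosed_closure.measurableSet.nullMeasurableSet) ⟨0, measure_ne_top _ _⟩]
  exact le_iInf fun k => (hB k).le.trans (measure_mono subset_closure)

/-- The minimum of a continuous `j` over the fibres of `f` in a compact set `K` selects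
measurably a point of each fibre. -/
theorem exists_measurable_fibre_selection {N Z : Type*} [TopologicalSpace N] [TopologicalSpace Z]
    [T2Space Z] [MeasurableSpace Z] [OpensMeasurableSpace Z] {f : N → Z} (hf : Continuous f)
    {j : N → ℝ} (hj : Continuous j) {K : Set N} (hK : IsCompact K) :
    ∃ s : Z → ℝ, Measurable s ∧ ∀ z ∈ f '' K, ∃ x, f x = z ∧ j x = s z := by
  let s : Z → ℝ := fun z => sInf (j '' (K ∩ f ⁻¹' {z}))
  have hc : ∀ z, IsCompact (j '' (K ∩ f ⁻¹' {z})) := fun z =>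
    (hK.inter_right (isClosed_singleton.preimage hf)).image hj
  have hmin : ∀ z ∈ f '' K, s z ∈ j '' (K ∩ f ⁻¹' {z}) := by
    rintro _ ⟨x, hx, rfl⟩
    exact (hc _).sInf_mem ⟨j x, x, ⟨hx, rfl⟩, rfl⟩
  refine ⟨s, measurable_of_Iic fun c => ?_, fun z hz => ?_⟩
  -- Off `f '' K` the fibre is empty and `sInf ∅ = 0`.
  · have heq : s ⁻¹' Iic c = f '' (K ∩ j ⁻¹' Iic c) ∪ ((f '' K)ᶜ ∩ {_z | (0 : ℝ) ≤ c}) := by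
      ext z
      by_cases hz : z ∈ f '' K
      · simp only [mem_preimage, mem_Iic, mem_union, mem_inter_iff, mem_compl_iff, hz,
          not_true_eq_false, false_and, or_false]
        constructor
        · intro h
          obtain ⟨x, ⟨hxK, hxz⟩, hx⟩ := hmin z hz
          exact ⟨x, ⟨hxK, by simpa [hx] using h⟩, hxz⟩
        · rintro ⟨x, ⟨hxK, hx⟩, hxz⟩
          exact (csInf_le (hc z).bddBelow ⟨x, ⟨hxK, hxz⟩, rfl⟩).trans hx
      · have h0 : K ∩ f ⁻¹' {z} = ∅ := by
          ext x
          simp only [mem_inter_iff, mem_preimage, mem_singleton_iff, mem_empty_iff_false, iff_false]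
          exact fun h => hz ⟨x, h⟩
        have h1 : z ∉ f '' (K ∩ j ⁻¹' Iic c) := fun h => hz (image_mono inter_subset_left h)
        simp [s, h0, hz, h1]
    rw [heq]
    refine .union ?_ (.inter (hK.image hf).isClosed.measurableSet.compl (.const _))
    exact ((hK.inter_right (isClosed_Iic.preimage hj)).image hf).isClosed.measurableSet
  · obtain ⟨x, hx, hxs⟩ := hmin z hz
    exact ⟨x, hx.2, hxs⟩

/-- Images of compact boxes exhaust the mass; the selections over them are glued by the least index
that applies. -/
theorem exists_measurable_ae_fibre_selection {Z : Type*} [TopologicalSpace Z] [T2Space Z]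
    [MeasurableSpace Z] [OpensMeasurableSpace Z] {f : (ℕ → ℕ) → Z} (hf : Continuous f)
    (hs : Function.Surjective f) {j : (ℕ → ℕ) → ℝ} (hj : Continuous j) (μ : Measure Z)
    [IsFiniteMeasure μ] :
    ∃ s : Z → ℝ, Measurable s ∧ ∀ᵐ z ∂μ, ∃ x, f x = z ∧ j x = s z := by
  classical
  rcases eq_or_ne (μ univ) 0 with h0 | h0
  · exact ⟨0, measurable_const, by simp [Measure.measure_univ_eq_zero.1 h0]⟩
  obtain ⟨r, -, hr, hrlim⟩ := exists_seq_strictMono_tendsto' (pos_iff_ne_zero.2 h0)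
  have hK : ∀ k, ∃ n : ℕ → ℕ, r k ≤ μ (f '' Iic n) := fun k =>
    exists_le_measure_image_Iic hf μ (by rw [hs.range_eq]; exact (hr k).2)
  choose n hn using hK
  have hcomp : ∀ k, IsCompact (Iic (n k)) := fun k => by
    rw [← Icc_bot]
    exact isCompact_Icc
  choose s hsm hsel using fun k => exists_measurable_fibre_selection hf hj (hcomp k)
  have hmK : ∀ k, MeasurableSet (f '' Iic (n k)) := fun k =>
    ((hcomp k).image hf).isClosed.measurableSet
  let U := ⋃ k, f '' Iic (n k)
  have hU : MeasurableSet U := .iUnion hmK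
  have hμU : μ Uᶜ = 0 := by
    rw [measure_compl hU (measure_ne_top _ _), tsub_eq_zero_iff_le]
    exact le_of_tendsto' hrlim fun k => (hn k).trans (measure_mono
      (subset_iUnion (fun k => f '' Iic (n k)) k))
  let p : ℕ → Z → Prop := fun k z => z ∈ f '' Iic (n k) ∨ z ∉ U
  have hp : ∀ z, ∃ k, p k z := fun z => by
    by_cases hz : z ∈ U
    · obtain ⟨k, hk⟩ := mem_iUnion.1 hz
      exact ⟨k, Or.inl hk⟩
    · exact ⟨0, Or.inr hz⟩
  refine ⟨fun z => s (Nat.find (hp z)) z, Measurable.find hsm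
    (p := p) (fun k => (hmK k).union hU.compl) hp, ?_⟩
  filter_upwards [compl_mem_ae_iff.2 hμU] with z hz
  exact hsel _ z ((Nat.find_spec (hp z)).resolve_right (not_not.2 (by simpa using hz)))

/-! ### Parametrization of probability measures -/

/-- A Markov kernel from a Polish space attaining every probability measure on the real line. -/
theorem exists_surjective_kernel_real : ∃ κ : Kernel (ℚ → ℝ) ℝ, IsMarkovKernel κ ∧
    ∀ μ : Measure ℝ, IsProbabilityMeasure μ → ∃ a, κ a = μ := by
  have hid : Measurable (id : (ℚ → ℝ) → ℚ → ℝ) := measurable_id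
  refine ⟨⟨_, measurable_measure_stieltjesOfMeasurableRat hid⟩,
    ⟨fun a => instIsProbabilityMeasure_stieltjesOfMeasurableRat hid a⟩, fun μ _ => ?_⟩
  let a : ℚ → ℝ := fun q => cdf μ q
  have ha : IsRatStieltjesPoint id a :=
    { mono := fun p q hpq => (cdf μ).mono (by exact_mod_cast hpq)
      tendsto_atTop_one := (tendsto_cdf_atTop μ).comp (tendsto_ratCast_atTop_iff.2 tendsto_id)
      tendsto_atBot_zero := (tendsto_cdf_atBot μ).comp (tendsto_ratCast_atBot_iff.2 tendsto_id)
      iInf_rat_gt_eq := fun t => by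
        change ⨅ r : Ioi t, cdf μ ((r : ℚ) : ℝ) = cdf μ t
        rw [← (cdf μ).iInf_rat_gt_eq t]
        exact (Equiv.subtypeEquivRight fun r => by simp).iInf_congr fun r => rfl }
  have hF : stieltjesOfMeasurableRat id hid a = cdf μ := by
    ext x
    rw [← StieltjesFunction.iInf_rat_gt_eq, ← StieltjesFunction.iInf_rat_gt_eq]
    simp_rw [stieltjesOfMeasurableRat_eq, toRatCDF_of_isRatStieltjesPoint ha]
    rfl
  refine ⟨a, ?_⟩
  change (stieltjesOfMeasurableRat id hid a).measure = μ
  rw [hF, measure_cdf]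

/-- A Markov kernel from a Polish space attaining every probability measure on a Souslin space. -/
theorem SouslinSpace.exists_surjective_kernel (Z : Type*) [TopologicalSpace Z] [SouslinSpace Z]
    [Nonempty Z] [MeasurableSpace Z] [BorelSpace Z] : ∃ κ : Kernel (ℚ → ℝ) Z, IsMarkovKernel κ ∧
    ∀ μ : Measure Z, IsProbabilityMeasure μ → ∃ a, κ a = μ := by
  have hZ := SouslinSpace.analyticSet_univ (X := Z)
  rw [AnalyticSet] at hZ
  obtain ⟨f, hf, hr⟩ := hZ.resolve_left univ_nonempty.ne_empty
  obtain ⟨j, hj, hji⟩ := exists_continuous_injective_nat_nat_real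
  obtain ⟨ψ, hψ, hψj⟩ := (hj.measurableEmbedding hji).exists_measurable_extend hf.measurable
    fun _ => ‹Nonempty Z›
  obtain ⟨κ, hκ, hκs⟩ := exists_surjective_kernel_real
  -- Since `ψ ∘ j = f`, the map `ψ` undoes the selection `s` almost everywhere, so `ψ` carries
  -- `μ.map s` back to `μ`.
  refine ⟨κ.map ψ, Kernel.IsMarkovKernel.map κ hψ, fun μ _ => ?_⟩
  obtain ⟨s, hs, hsel⟩ := exists_measurable_ae_fibre_selection hf (range_eq_univ.1 hr) hj μ
  obtain ⟨a, ha⟩ := hκs (μ.map s) (Measure.isProbabilityMeasure_map hs.aemeasurable)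
  refine ⟨a, ?_⟩
  rw [Kernel.map_apply _ hψ, ha, Measure.map_map hψ hs]
  refine (Measure.map_congr (g := id) ?_).trans Measure.map_id
  filter_upwards [hsel] with z ⟨x, hx, hxs⟩
  rw [Function.comp_apply, ← hxs, ← hx]
  exact congrFun hψj x

/-! ### Sublevel sets of the cost -/

theorem analyticSet_setOf_kantorovichCost_lt {T X Y : Type*}
    [TopologicalSpace T] [SouslinSpace T] [MeasurableSpace T] [BorelSpace T]
    [TopologicalSpace X] [SouslinSpace X] [MeasurableSpace X] [BorelSpace X]
    [TopologicalSpace Y] [SouslinSpace Y] [MeasurableSpace Y] [BorelSpace Y]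
    {h : T × X × Y → ℝ≥0} (h_meas : Measurable h)
    {μ : T → ProbabilityMeasure X} {ν : T → ProbabilityMeasure Y}
    (hμ : Measurable fun t => (μ t : Measure X)) (hν : Measurable fun t => (ν t : Measure Y))
    (c : ℝ≥0∞) :
    AnalyticSet {t | kantorovichCost (fun z : X × Y => h (t, z)) (μ t) (ν t) < c} := by
  rcases isEmpty_or_nonempty T with hT | ⟨⟨t₀⟩⟩
  · rw [eq_empty_of_isEmpty {t | _ < c}]
    exact analyticSet_empty
  have : Nonempty X := (μ t₀ : Measure X).nonempty_of_neZero
  have : Nonempty Y := (ν t₀ : Measure Y).nonempty_of_neZero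
  obtain ⟨-, P, i, j, f, hf, hs⟩ := (souslinSpace_iff T).1 ‹_›
  let : MeasurableSpace P := borel P
  have : BorelSpace P := ⟨rfl⟩
  have hfm : Measurable f := hf.measurable
  obtain ⟨κ, hκ, hκs⟩ := SouslinSpace.exists_surjective_kernel (X × Y)
  let S : Set (P × (ℚ → ℝ)) :=
    {p | (κ p.2).map Prod.fst = μ (f p.1) ∧ (κ p.2).map Prod.snd = ν (f p.1) ∧
      ∫⁻ z, (h (f p.1, z) : ℝ≥0∞) ∂(κ p.2) < c}
  have hκm : Measurable fun p : P × (ℚ → ℝ) => κ p.2 := κ.measurable.comp measurable_snd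
  have hS : MeasurableSet S := by
    have h1 : MeasurableSet {p : P × (ℚ → ℝ) | (κ p.2).map Prod.fst = μ (f p.1)} := by
      have : ∀ p : P × (ℚ → ℝ), IsProbabilityMeasure ((κ p.2).map Prod.fst) :=
        fun p => Measure.isProbabilityMeasure_map measurable_fst.aemeasurable
      exact measurableSet_setOf_measure_eq ((Measure.measurable_map _ measurable_fst).comp hκm)
        (hμ.comp (hfm.comp measurable_fst))
    have h2 : MeasurableSet {p : P × (ℚ → ℝ) | (κ p.2).map Prod.snd = ν (f p.1)} := by
      have : ∀ p : P × (ℚ → ℝ), IsProbabilityMeasure ((κ p.2).map Prod.snd) :=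
        fun p => Measure.isProbabilityMeasure_map measurable_snd.aemeasurable
      exact measurableSet_setOf_measure_eq ((Measure.measurable_map _ measurable_snd).comp hκm)
        (hν.comp (hfm.comp measurable_fst))
    have h3 : Measurable fun p : P × (ℚ → ℝ) => ∫⁻ z, (h (f p.1, z) : ℝ≥0∞) ∂(κ p.2) := by
      have hh : Measurable fun q : (P × (ℚ → ℝ)) × (X × Y) => (h (f q.1.1, q.2) : ℝ≥0∞) :=
        (h_meas.comp ((hfm.comp (measurable_fst.comp measurable_fst)).prodMk
          measurable_snd)).coe_nnreal_ennreal
      exact hh.lintegral_kernel_prod_right' (κ := κ.comap Prod.snd measurable_snd)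
    exact h1.inter (h2.inter (measurableSet_lt h3 measurable_const))
  convert! hS.analyticSet.image_of_continuous (hf.comp continuous_fst) using 1
  ext t
  simp only [kantorovichCost, transportPlans, mem_ofPred_eq, iInf_lt_iff, mem_image]
  constructor
  · rintro ⟨σ, ⟨h1, h2⟩, h3⟩
    obtain ⟨p, rfl⟩ := hs t
    obtain ⟨a, ha⟩ := hκs σ inferInstance
    exact ⟨(p, a), ⟨by rwa [ha], by rwa [ha], by rwa [ha]⟩, rfl⟩
  · rintro ⟨p, ⟨h1, h2, h3⟩, rfl⟩
    exact ⟨⟨κ p.2, inferInstance⟩, ⟨h1, h2⟩, h3⟩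

/-- Here `ProbabilityMeasure X` carries its topology of weak convergence, and the
families of marginals are measurable for the corresponding Borel σ-algebras. -/
theorem mainTheorem7 {T X Y : Type*}
    [TopologicalSpace T] [SouslinSpace T] [MeasurableSpace T] [BorelSpace T]
    [TopologicalSpace X] [SouslinSpace X] [CompletelyRegularSpace X]
    [MeasurableSpace X] [BorelSpace X]
    [TopologicalSpace Y] [SouslinSpace Y] [CompletelyRegularSpace Y]
    [MeasurableSpace Y] [BorelSpace Y]
    (h : T × X × Y → ℝ≥0) (h_meas : Measurable h)
    (h_cont : ∀ t, Continuous fun z : X × Y => h (t, z))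
    (μ : T → ProbabilityMeasure X) (ν : T → ProbabilityMeasure Y)
    (hμ : Measurable[borel T, borel (ProbabilityMeasure X)] μ)
    (hν : Measurable[borel T, borel (ProbabilityMeasure Y)] ν) :
    Measurable[souslinSigmaAlgebra T, borel ℝ≥0∞]
      fun t => kantorovichCost (fun z : X × Y => h (t, z)) (μ t) (ν t) := by
  borelize ℝ≥0∞
  refine measurable_of_Iio (mδ := souslinSigmaAlgebra T) fun c =>
    MeasurableSpace.measurableSet_generateFrom ?_
  rw [← BorelSpace.measurable_eq (α := T)] at hμ hν
  exact analyticSet_setOf_kantorovichCost_lt h_meas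
    ((ProbabilityMeasure.measurable_coe_of_borel X).comp hμ)
    ((ProbabilityMeasure.measurable_coe_of_borel Y).comp hν) c
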